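/- A \emph{kernel} is a triple $(J,\mu,W)$ where $(J,\mu)$ is a probability space and $W\colon J^3\to\mathbf{R}$ is bounded and measurable. For $n\ge 1$ let $\mathbf{H}(W,n)\colon[n]^3\to\mathbf{R}$ be the random function $(i,j,k)\mapsto W(x_i,x_j,x_k)$, where $x_1,\dots,x_n$ are independent with law $\mu$; for $H\colon[n]^3\to\mathbf{R}$ the \emph{density} of $H$ in $W$ is $t(H,W)=\mathbf{P}(\mathbf{H}(W,n)=H)$. The \emph{neighborhood pseudo-distance} of the kernel is $$d_W(x,x')=\int_{J^2}|W(x,y,z)-W(x',y,z)|\,d\mu(y)\,d\mu(z).$$ The kernel is \emph{pure} if $d_W$ is a distance, $(J,d_W)$ is complete and separable, and every non-empty open set of $(J,d_W)$ has positive $\mu$-measure. Let $(J_1,\mu_1,W_1)$ and $(J_2,\mu_2,W_2)$ be two pure kernels such that, for $i\in\{1,2\}$, $\mu_i$ is a (possibly completed) Borel measure on $(J_i,d_{W_i})$, that is, every measurable subset of $J_i$ belongs to the $\mu_i$-completion of the Borel $\sigma$-algebra of $(J_i,d_{W_i})$. Suppose that the two kernels have the same sampling distributions, i.e. $\mathbf{H}(W_1,n)$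 and $\mathbf{H}(W_2,n)$ have the same law for every $n\ge1$; or that $W_1$ takes at most countably many values and $t(H,W_1)=t(H,W_2)$ for every $n\ge 1$ and every $H\colon[n]^3\to\mathbf{R}$. Then there exists a bijective isometry $\rho\colon(J_1,d_{W_1})\to(J_2,d_{W_2})$ such that $\rho$ and $\rho^{-1}$ are measure preserving (the preimage of every set measurable for the completed measure is measurable for the completed measure and has the same measure), and $W_1(x,y,z)=W_2(\rho(x),\rho(y),\rho(z))$ for $\mu_1^3$-almost every $(x,y,z)\in J_1^3$. -/

import Mathlib

open MeasureTheory

noncomputable section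

/-- A kernel `(J, μ, W)` on triples: a probability measure `μ` on `J` together with a bounded
measurable function `W` on `J³` (with the product σ-algebra). -/
structure TripleKernel (J : Type*) [MeasurableSpace J] where
  μ : Measure J
  isProbabilityMeasure : IsProbabilityMeasure μ
  W : J → J → J → ℝ
  measurable_W : Measurable fun p : J × J × J => W p.1 p.2.1 p.2.2
  bounded_W : ∃ C : ℝ, ∀ x y z, |W x y z| ≤ C

attribute [instance] TripleKernel.isProbabilityMeasure

namespace TripleKernel

variable {J : Type*} [MeasurableSpace J] (K : TripleKernel J)

/-- The function `(i, j, k) ↦ W (x i) (x j) (x k)` on `[n]³` defined by an `n`-tuple of points. -/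
def sample (n : ℕ) (x : Fin n → J) : Fin n → Fin n → Fin n → ℝ :=
  fun i j k => K.W (x i) (x j) (x k)

/-- The distribution of the random function `sample n x` on `[n]³`, where `x` is a `μⁿ`-random
tuple. -/
def sampleLaw (n : ℕ) : Measure (Fin n → Fin n → Fin n → ℝ) :=
  (Measure.pi fun _ : Fin n => K.μ).map (K.sample n)

/-- The density `t(H, W)`: the probability that the random function `sample n x` equals `H`. -/
def density {n : ℕ} (H : Fin n → Fin n → Fin n → ℝ) : ENNReal :=
  (Measure.pi fun _ : Fin n => K.μ) {x | K.sample n x = H}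

/-- The neighborhood pseudo-distance
`d_W x x' = ∫ |W(x, y, z) - W(x', y, z)| dμ(y) dμ(z)`. -/
def nbhdDist (x x' : J) : ℝ :=
  ∫ p : J × J, |K.W x p.1 p.2 - K.W x' p.1 p.2| ∂(K.μ.prod K.μ)

lemma integrable_section (x : J) :
    Integrable (fun p : J × J => K.W x p.1 p.2) (K.μ.prod K.μ) := by
  obtain ⟨C, hC⟩ := K.bounded_W
  refine Integrable.of_bound (C := C) ?_ (Filter.Eventually.of_forall fun p => hC x p.1 p.2)
  exact (K.measurable_W.comp (measurable_const.prodMk measurable_id :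
    Measurable fun p : J × J => (x, p))).aestronglyMeasurable

/-- `J` as a pseudometric space for the neighborhood pseudo-distance. -/
@[reducible] def nbhdPseudoMetric : PseudoMetricSpace J where
  dist := K.nbhdDist
  dist_self x := by simp [nbhdDist]
  dist_comm x y := by simp only [nbhdDist, abs_sub_comm]
  dist_triangle x y z := by
    have h : ∀ a b : J, Integrable (fun p : J × J => |K.W a p.1 p.2 - K.W b p.1 p.2|)
        (K.μ.prod K.μ) :=
      fun a b => ((K.integrable_section a).sub (K.integrable_section b)).abs
    simp only [nbhdDist]
    rw [← integral_add (h x y) (h y z)]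
    exact integral_mono (h x z) ((h x y).add (h y z)) fun p => abs_sub_le _ _ _

/-- The topology induced by the neighborhood pseudo-distance. -/
@[reducible] def nbhdTopology : TopologicalSpace J :=
  K.nbhdPseudoMetric.toUniformSpace.toTopologicalSpace

/-- A kernel is pure if the neighborhood pseudo-distance is a distance, for which `J` is complete
and separable, and every non-empty open set has positive measure. -/
structure IsPure : Prop where
  eq_of_nbhdDist_eq_zero : ∀ x x' : J, K.nbhdDist x x' = 0 → x = x'
  complete : @CompleteSpace J K.nbhdPseudoMetric.toUniformSpace
  separable : @TopologicalSpace.SeparableSpace J K.nbhdTopology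
  fullSupport : ∀ U : Set J, @IsOpen J K.nbhdTopology U → U.Nonempty → 0 < K.μ U

/-- `μ` is a (possibly completed) Borel measure on `(J, d_W)`: every measurable set lies between
two Borel sets of `(J, d_W)` whose difference is `μ`-null. (The Borel sets of a pure kernel are
automatically measurable.) -/
def IsBorelUpToCompletion : Prop :=
  ∀ A : Set J, MeasurableSet A →
    ∃ B C : Set J, MeasurableSet[@borel J K.nbhdTopology] B ∧
      MeasurableSet[@borel J K.nbhdTopology] C ∧ B ⊆ A ∧ A ⊆ C ∧ K.μ (C \ B) = 0

end TripleKernel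

/-- `f` is measure preserving: the preimage of every `ν`-measurable set (that is, measurable for
the completion of `ν`) is `μ`-measurable, of the same measure. -/
def PreservesMeasure {X Y : Type*} [MeasurableSpace X] [MeasurableSpace Y] (μ : Measure X)
    (ν : Measure Y) (f : X → Y) : Prop :=
  ∀ A : Set Y, NullMeasurableSet A ν → NullMeasurableSet (f ⁻¹' A) μ ∧ μ (f ⁻¹' A) = ν A

end

/-! A pure kernel can be rebuilt from the values of `W` on one random i.i.d. sequence of points,
using only triples with distinct indices. The distance between two sample points is the limit of
averages of `|W(x, y, z) - W(x', y, z)|` over fresh independent pairs. Full support makes the sample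
dense, so these distances determine the space by completion. They also decide which sample points
lie in boxes built from balls around sample points; averages over fresh triples then recover the
measure of each box and the integral of `W` over it. Such boxes generate the Borel sets and are
stable under intersection, so the measure is determined, and `W` almost everywhere
(`IsGenericSample.exists_isometryEquiv`).

Equality of sampling laws gives equality of the laws of the infinite off-diagonal arrays. Almost
every array for this common law comes from a generic sample of each kernel (`ae_map_exists_eq`), so
some array comes from both, and the two reconstructions agree.

The σ-algebra on `J` may exceed the Borel one, so `W` is first replaced by an almost everywhere
equal Borel function (`exists_isMetricKernel`). The distance formula and the law of the off-diagonal
array survive this change; diagonal values need not, which is why they are never used. -/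

open ProbabilityTheory Filter Topology

/-! ### Laws of large numbers for i.i.d. families -/

section Probability

/-- If `p` holds almost surely and `f` is measurable, then almost every value of `f` is attained
at a point satisfying `p`. -/
lemma ae_map_exists_eq {Ω A : Type*} [MeasurableSpace Ω] [StandardBorelSpace Ω]
    [MeasurableSpace A] [MeasurableEq A] {P : Measure Ω} [IsProbabilityMeasure P]
    {f : Ω → A} (hf : Measurable f) {p : Ω → Prop} (hp : ∀ᵐ ω ∂P, p ω) :
    ∀ᵐ a ∂P.map f, ∃ ω, p ω ∧ f ω = a := by
  have : Nonempty Ω := nonempty_of_isProbabilityMeasure P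
  have hg : Measurable fun ω => (f ω, ω) := hf.prodMk measurable_id
  -- Disintegrate the joint law over `f ω`: for almost every value `a`, the conditional measure is a
  -- probability measure carried by the wanted points, which therefore exist. No measurability of
  -- `p` or of an image set is needed.
  set ρ := P.map fun ω => (f ω, ω) with hρ
  have : IsProbabilityMeasure ρ := Measure.isProbabilityMeasure_map hg.aemeasurable
  have h1 : ∀ᵐ z ∂ρ, p z.2 := by
    have : ∀ᵐ ω ∂ρ.map Prod.snd, p ω := by
      rw [hρ, Measure.map_map measurable_snd hg]
      simpa [Function.comp_def] using hp
    exact ae_of_ae_map measurable_snd.aemeasurable this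
  have h2 : ∀ᵐ z ∂ρ, f z.2 = z.1 := by
    have hs : MeasurableSet {z : A × Ω | f z.2 = z.1} :=
      measurableSet_eq_fun (hf.comp measurable_snd) measurable_fst
    rw [hρ, ae_map_iff hg.aemeasurable hs]
    simp
  have h3 : ∀ᵐ z ∂ρ.fst ⊗ₘ ρ.condKernel, p z.2 ∧ f z.2 = z.1 := by
    rw [ρ.disintegrate]
    exact h1.and h2
  have h4 : ρ.fst = P.map f := Measure.fst_map_prodMk measurable_id
  rw [← h4]
  filter_upwards [Measure.ae_ae_of_ae_compProd h3] with a ha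
  exact ha.exists

/-- The strong law of large numbers with an independent parameter. -/
lemma ae_prod_tendsto_average {A Y : Type*} [MeasurableSpace A] [MeasurableSpace Y]
    (α : Measure A) [IsProbabilityMeasure α] (ν : Measure Y) [IsProbabilityMeasure ν]
    {F : A → Y → ℝ} (hF : Measurable fun z : A × Y => F z.1 z.2) {C : ℝ}
    (hC : ∀ a y, |F a y| ≤ C) :
    ∀ᵐ z ∂α.prod (Measure.infinitePi fun _ : ℕ => ν),
      Tendsto (fun n : ℕ => (∑ k ∈ Finset.range n, F z.1 (z.2 k)) / n) atTop
        (𝓝 (∫ y, F z.1 y ∂ν)) := by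
  have hint : Measurable fun a => ∫ y, F a y ∂ν :=
    (hF.stronglyMeasurable.integral_prod_right (f := fun a y => F a y)).measurable
  have hk : ∀ k : ℕ, Measurable fun z : A × (ℕ → Y) => F z.1 (z.2 k) := fun k =>
    hF.comp (measurable_fst.prodMk ((measurable_pi_apply k).comp measurable_snd))
  have hmeas : MeasurableSet {z : A × (ℕ → Y) |
      Tendsto (fun n : ℕ => (∑ k ∈ Finset.range n, F z.1 (z.2 k)) / n) atTop
        (𝓝 (∫ y, F z.1 y ∂ν))} :=
    measurableSet_tendsto_fun
      (fun n => (Finset.measurable_sum _ fun k _ => hk k).div_const _)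
      (hint.comp measurable_fst)
  rw [Measure.ae_prod_iff_ae_ae hmeas]
  refine Eventually.of_forall fun a => ?_
  have hFa : Measurable (F a) := hF.comp (measurable_const.prodMk measurable_id)
  have hX : ∀ k : ℕ, Measurable fun y : ℕ → Y => F a (y k) := fun k =>
    hFa.comp (measurable_pi_apply k)
  have hmap : ∀ k : ℕ, (Measure.infinitePi fun _ : ℕ => ν).map (fun y : ℕ → Y => F a (y k)) =
      ν.map (F a) := fun k => by
    conv_rhs => rw [← Measure.infinitePi_map_eval (fun _ : ℕ => ν) k,
      Measure.map_map hFa (measurable_pi_apply k)]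
    rfl
  have key := strong_law_ae_real (μ := Measure.infinitePi fun _ : ℕ => ν)
    (fun k y => F a (y k))
    (Integrable.of_bound (hX 0).aestronglyMeasurable C (Eventually.of_forall fun y => hC a (y 0)))
    (fun i j hij => (iIndepFun_infinitePi (P := fun _ : ℕ => ν) (X := fun _ => F a)
      (fun _ => hFa)).indepFun hij)
    (fun i => ⟨(hX i).aemeasurable, (hX 0).aemeasurable, by rw [hmap, hmap]⟩)
  have hE : ∫ y, F a (y 0) ∂(Measure.infinitePi fun _ : ℕ => ν) = ∫ y, F a y ∂ν := by
    conv_rhs => rw [← Measure.infinitePi_map_eval (fun _ : ℕ => ν) 0]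
    rw [integral_map (measurable_pi_apply 0).aemeasurable hFa.aestronglyMeasurable]
  simpa only [hE] using key

variable {X : Type*} [MeasurableSpace X] (ν : Measure X) [IsProbabilityMeasure ν]

/-- A finite-dimensional box over the disjoint union factors into a box over each part. This makes
the parameters independent of the averaged blocks. -/
lemma infinitePi_map_sum {α β : Type*} :
    (Measure.infinitePi fun _ : α ⊕ β => ν).map
        (fun ω => (fun a => ω (Sum.inl a), fun b => ω (Sum.inr b))) =
      (Measure.infinitePi fun _ : α => ν).prod (Measure.infinitePi fun _ : β => ν) := by
  have hm : Measurable fun p : (α → X) × (β → X) => (Sum.elim p.1 p.2 : α ⊕ β → X) := by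
    refine measurable_pi_iff.2 ?_
    rintro (a | b)
    · exact (measurable_pi_apply a).comp measurable_fst
    · exact (measurable_pi_apply b).comp measurable_snd
  have h : ((Measure.infinitePi fun _ : α => ν).prod (Measure.infinitePi fun _ : β => ν)).map
      (fun p => (Sum.elim p.1 p.2 : α ⊕ β → X)) = Measure.infinitePi fun _ : α ⊕ β => ν := by
    refine Measure.eq_infinitePi _ fun s t ht => ?_
    rw [Measure.map_apply hm (.pi s.countable_toSet fun _ _ => ht _)]
    have : (fun p : (α → X) × (β → X) => (Sum.elim p.1 p.2 : α ⊕ β → X)) ⁻¹' (Set.pi s t) =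
        (Set.pi s.toLeft fun a => t (Sum.inl a)) ×ˢ (Set.pi s.toRight fun b => t (Sum.inr b)) := by
      ext p
      simp [Set.mem_pi]
    rw [this, Measure.prod_prod, Measure.infinitePi_pi _ fun _ _ => ht _,
      Measure.infinitePi_pi _ fun _ _ => ht _]
    conv_rhs => rw [← Finset.toLeft_disjSum_toRight (u := s), Finset.prod_disjSum]
  rw [← h, Measure.map_map (by fun_prop) hm]
  simp [Function.comp_def]

/-- The strong law of large numbers for disjoint blocks of an i.i.d. family, with a parameter
depending on the remaining members of the family. -/
lemma ae_tendsto_block_average {B κ : Type*}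
    {F : (B → X) → (κ → X) → ℝ} (hF : Measurable fun z : (B → X) × (κ → X) => F z.1 z.2)
    {C : ℝ} (hC : ∀ a y, |F a y| ≤ C) :
    ∀ᵐ ω ∂Measure.infinitePi fun _ : B ⊕ ℕ × κ => ν,
      Tendsto (fun n : ℕ => (∑ k ∈ Finset.range n,
          F (fun b => ω (Sum.inl b)) (fun j => ω (Sum.inr (k, j)))) / n) atTop
        (𝓝 (∫ y, F (fun b => ω (Sum.inl b)) y ∂Measure.infinitePi fun _ : κ => ν)) := by
  have h := ae_prod_tendsto_average (Measure.infinitePi fun _ : B => ν)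
    (Measure.infinitePi fun _ : κ => ν) hF hC
  have e : (Measure.infinitePi fun _ : B ⊕ ℕ × κ => ν).map
      (fun ω => (fun b => ω (Sum.inl b), fun (k : ℕ) (j : κ) => ω (Sum.inr (k, j)))) =
      (Measure.infinitePi fun _ : B => ν).prod
        (Measure.infinitePi fun _ : ℕ => Measure.infinitePi fun _ : κ => ν) := by
    rw [← Measure.infinitePi_map_curry (fun (_ : ℕ) (_ : κ) => ν)]
    have := Measure.map_prod_map (Measure.infinitePi fun _ : B => ν)
      (Measure.infinitePi fun _ : ℕ × κ => ν) measurable_id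
      (MeasurableEquiv.curry ℕ κ X).measurable
    rw [Measure.map_id] at this
    rw [this, ← infinitePi_map_sum, Measure.map_map (by fun_prop) (by fun_prop)]
    rfl
  rw [← e] at h
  exact ae_of_ae_map (by fun_prop) h

lemma infinitePi_map_eval_triple {ι : Type*} {i j k : ι} (hij : i ≠ j) (hik : i ≠ k)
    (hjk : j ≠ k) :
    (Measure.infinitePi fun _ : ι => ν).map (fun ω => (ω i, ω j, ω k)) =
      ν.prod (ν.prod ν) := by
  have hI := iIndepFun_infinitePi (P := fun _ : ι => ν) (X := fun _ ω => ω)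
    (fun _ => measurable_id)
  have h := (hI.indepFun_prodMk (fun i => measurable_pi_apply i) j k i hij.symm hik.symm).symm
  rw [h.map_prod_eq_prod_map_map (measurable_pi_apply i).aemeasurable
    ((measurable_pi_apply j).prodMk (measurable_pi_apply k)).aemeasurable, Measure.infinitePi_map_eval,
    Measure.infinitePi_map_eval_prod hjk]

/-- An i.i.d. sequence visits every set of positive measure. -/
lemma ae_exists_mem_of_pos {U : Set X} (hU : MeasurableSet U) (hpos : 0 < ν U) :
    ∀ᵐ ω ∂Measure.infinitePi fun _ : ℕ => ν, ∃ n, ω n ∈ U := by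
  have hlt : ν Uᶜ < 1 := by
    rw [prob_compl_eq_one_sub hU]
    exact ENNReal.sub_lt_self ENNReal.one_ne_top one_ne_zero hpos.ne'
  -- Missing `U` forever implies missing it in the first `n` independent draws.
  have hle : ∀ n : ℕ, (Measure.infinitePi fun _ : ℕ => ν) {ω | ¬ ∃ n, ω n ∈ U} ≤ ν Uᶜ ^ n := by
    intro n
    calc _ ≤ (Measure.infinitePi fun _ : ℕ => ν) (Set.pi (Finset.range n) fun _ => Uᶜ) :=
          measure_mono fun ω (hω : ¬ ∃ n, ω n ∈ U) i _ hi => hω ⟨i, hi⟩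
      _ = _ := by rw [Measure.infinitePi_pi _ fun _ _ => hU.compl]; simp
  exact le_antisymm (ge_of_tendsto' (ENNReal.tendsto_pow_atTop_nhds_zero_of_lt_one hlt) hle)
    zero_le

end Probability

/-! ### Deterministic uniqueness and extension tools -/

/-- Two integrable functions with the same integrals over a generating π-system are almost
everywhere equal. -/
lemma ae_eq_of_setIntegral_eq_of_isPiSystem {X : Type*} [m : MeasurableSpace X] {ν : Measure X}
    [IsFiniteMeasure ν] {f g : X → ℝ} (hf : Integrable f ν) (hg : Integrable g ν)
    {S : Set (Set X)} (hS : m = MeasurableSpace.generateFrom S) (hpi : IsPiSystem S)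
    (huniv : ∫ x, f x ∂ν = ∫ x, g x ∂ν)
    (h : ∀ s ∈ S, ∫ x in s, f x ∂ν = ∫ x in s, g x ∂ν) : f =ᵐ[ν] g := by
  have key : ∀ s, MeasurableSet s → ∫ x in s, f x ∂ν = ∫ x in s, g x ∂ν := by
    intro s hs
    induction s, hs using MeasurableSpace.induction_on_inter hS hpi with
    | empty => simp
    | basic t ht => exact h t ht
    | compl t ht ih =>
      have h1 := integral_add_compl ht hf
      have h2 := integral_add_compl ht hg
      linarith
    | iUnion t hd ht ih =>
      rw [integral_iUnion ht hd hf.integrableOn, integral_iUnion ht hd hg.integrableOn]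
      simp only [ih]
  exact hf.ae_eq_of_forall_setIntegral_eq _ _ hg fun s hs _ => key s hs

/-- Two complete metric spaces with dense sequences having the same mutual distances are
isometric. -/
lemma exists_isometryEquiv_of_dist_eq {X Y ι : Type*} [MetricSpace X] [CompleteSpace X]
    [MetricSpace Y] [CompleteSpace Y] {x : ι → X} {y : ι → Y} (hx : DenseRange x)
    (hy : DenseRange y) (h : ∀ i j, dist (x i) (x j) = dist (y i) (y j)) :
    ∃ ρ : X ≃ᵢ Y, ∀ i, ρ (x i) = y i := by
  -- With the common pseudo-distance on the index set, both spaces are completions of it, and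
  -- completions are unique.
  let : PseudoMetricSpace ι := PseudoMetricSpace.induced x inferInstance
  have hxi : Isometry x := Isometry.of_dist_eq fun _ _ => rfl
  have hyi : Isometry y := Isometry.of_dist_eq fun i j => (h i j).symm
  let px : AbstractCompletion ι := ⟨X, x, inferInstance, inferInstance, inferInstance,
    hxi.isUniformInducing, hx⟩
  let py : AbstractCompletion ι := ⟨Y, y, inferInstance, inferInstance, inferInstance,
    hyi.isUniformInducing, hy⟩
  let e : X ≃ᵤ Y := px.compareEquiv py
  have he : ∀ i, e (x i) = y i := fun i => px.compare_coe py i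
  have hd : ∀ a b, dist (e a) (e b) = dist a b := fun a b =>
    hx.induction_on₂ (p := fun a b => dist (e a) (e b) = dist a b)
      (isClosed_eq (by have := e.continuous; fun_prop) (by fun_prop))
      (fun i j => by rw [he, he, h]) a b
  exact ⟨⟨e.toEquiv, Isometry.of_dist_eq hd⟩, he⟩

/-! ### Off-diagonal arrays and index sets -/

/-- Triples of distinct indices. -/
def OffDiag (I : Type*) : Type _ :=
  {t : I × I × I // t.1 ≠ t.2.1 ∧ t.1 ≠ t.2.2 ∧ t.2.1 ≠ t.2.2}

instance {I : Type*} [Countable I] : Countable (OffDiag I) := Subtype.countable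

/-- The values of `W` on the triples of points of the family `ω` with distinct indices. -/
def offDiagArray {X I : Type*} (W : X → X → X → ℝ) (ω : I → X) : OffDiag I → ℝ :=
  fun t => W (ω t.1.1) (ω t.1.2.1) (ω t.1.2.2)

lemma measurable_offDiagArray {X I : Type*} [MeasurableSpace X] {W : X → X → X → ℝ}
    (hW : Measurable fun p : X × X × X => W p.1 p.2.1 p.2.2) :
    Measurable (offDiagArray (I := I) W) :=
  measurable_pi_iff.2 fun t =>
    hW.comp (f := fun ω : I → X => (ω t.1.1, ω t.1.2.1, ω t.1.2.2)) (by fun_prop)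

/-- Indices of the points whose mutual distances are observed: a sequence of centers and a sequence
of triples. -/
abbrev BaseIndex : Type := ℕ ⊕ ℕ × Fin 3

/-- Indices of the random sample: the base points and a sequence of pairs used to estimate
the distances. -/
abbrev SampleIndex : Type := BaseIndex ⊕ ℕ × Fin 2

/-! ### The π-system of finite intersections of balls -/

section Balls

variable {X : Type*} [MetricSpace X]

/-- A finite intersection of balls with rational radii, centered at points of the sequence `x`. -/
def ballInter (x : ℕ → X) (s : Finset (ℕ × ℚ)) : Set X := {a | ∀ q ∈ s, dist a (x q.1) < q.2}

/-- A product of three finite intersections of balls. -/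
def ballBox (x : ℕ → X) (s : Fin 3 → Finset (ℕ × ℚ)) : Set (X × X × X) :=
  ballInter x (s 0) ×ˢ ballInter x (s 1) ×ˢ ballInter x (s 2)

@[simp] lemma ballInter_empty (x : ℕ → X) : ballInter x ∅ = Set.univ := by simp [ballInter]

lemma ballInter_union (x : ℕ → X) (s t : Finset (ℕ × ℚ)) :
    ballInter x (s ∪ t) = ballInter x s ∩ ballInter x t := by
  ext a
  simp only [ballInter, Finset.mem_union, Set.mem_ofPred_eq, Set.mem_inter_iff]
  exact ⟨fun h => ⟨fun q hq => h q (Or.inl hq), fun q hq => h q (Or.inr hq)⟩,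
    fun h q hq => hq.elim (h.1 q) (h.2 q)⟩

lemma isOpen_ballInter (x : ℕ → X) (s : Finset (ℕ × ℚ)) : IsOpen (ballInter x s) := by
  have : ballInter x s = ⋂ q ∈ s, Metric.ball (x q.1) q.2 := by
    ext a
    simp [ballInter]
  rw [this]
  exact isOpen_biInter_finset fun q _ => Metric.isOpen_ball

lemma isPiSystem_range_ballInter (x : ℕ → X) : IsPiSystem (Set.range (ballInter x)) := by
  rintro _ ⟨s, rfl⟩ _ ⟨t, rfl⟩ -
  exact ⟨s ∪ t, ballInter_union x s t⟩

lemma isCountablySpanning_range_ballInter (x : ℕ → X) :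
    IsCountablySpanning (Set.range (ballInter x)) :=
  ⟨fun _ => Set.univ, fun _ => ⟨∅, ballInter_empty x⟩, Set.iUnion_const _⟩

lemma generateFrom_range_ballInter [SecondCountableTopology X] [m : MeasurableSpace X]
    [BorelSpace X] {x : ℕ → X} (hx : DenseRange x) :
    MeasurableSpace.generateFrom (Set.range (ballInter x)) = m := by
  refine le_antisymm (MeasurableSpace.generateFrom_le ?_) ?_
  · rintro _ ⟨s, rfl⟩
    exact (isOpen_ballInter x s).measurableSet
  have hb : TopologicalSpace.IsTopologicalBasis
      (Set.range fun q : ℕ × ℚ => Metric.ball (x q.1) (q.2 : ℝ)) := by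
    refine TopologicalSpace.isTopologicalBasis_of_isOpen_of_nhds ?_ fun a U ha hU => ?_
    · rintro _ ⟨q, rfl⟩
      exact Metric.isOpen_ball
    obtain ⟨ε, hε, hεU⟩ := Metric.isOpen_iff.1 hU a ha
    -- With `r < ε / 2`, a ball of radius `r` containing `a` has all its points within `2 * r < ε`
    -- of `a`.
    obtain ⟨r, hr0, hr⟩ := exists_rat_btwn (half_pos hε)
    obtain ⟨n, hn⟩ := hx.exists_dist_lt a hr0
    refine ⟨_, ⟨(n, r), rfl⟩, hn, fun b hb => hεU ?_⟩
    rw [Metric.mem_ball] at hb ⊢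
    have := dist_triangle_right b a (x n)
    simp only at hb
    linarith
  rw [BorelSpace.measurable_eq (α := X), hb.borel_eq_generateFrom]
  refine MeasurableSpace.generateFrom_mono ?_
  rintro _ ⟨q, rfl⟩
  refine ⟨{q}, ?_⟩
  ext a
  simp [ballInter]

end Balls

/-! ### Almost every sample is generic -/

/-- A kernel on a metric space for which almost every distance is the neighborhood distance. -/
structure IsMetricKernel {X : Type*} [MetricSpace X] [MeasurableSpace X] (ν : Measure X)
    (W : X → X → X → ℝ) : Prop where
  measurable : Measurable fun p : X × X × X => W p.1 p.2.1 p.2.2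
  bounded : ∃ C : ℝ, ∀ x y z, |W x y z| ≤ C
  dist_eq : ∀ᵐ p ∂ν.prod ν, dist p.1 p.2 = ∫ q, |W p.1 q.1 q.2 - W p.2 q.1 q.2| ∂ν.prod ν

/-- A sample of a kernel for which the required laws of large numbers hold. -/
structure IsGenericSample {X : Type*} [MetricSpace X] [MeasurableSpace X] (ν : Measure X)
    (W : X → X → X → ℝ) (ω : SampleIndex → X) : Prop where
  dense : DenseRange fun n => ω (.inl (.inl n))
  tendsto_dist : ∀ b b' : BaseIndex, b ≠ b' → Tendsto (fun n : ℕ => (∑ k ∈ Finset.range n,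
      |W (ω (.inl b)) (ω (.inr (k, 0))) (ω (.inr (k, 1))) -
        W (ω (.inl b')) (ω (.inr (k, 0))) (ω (.inr (k, 1)))|) / n) atTop
      (𝓝 (dist (ω (.inl b)) (ω (.inl b'))))
  tendsto_measure : ∀ s : Fin 3 → Finset (ℕ × ℚ), Tendsto (fun n : ℕ => (∑ k ∈ Finset.range n,
      (ballBox (fun n => ω (.inl (.inl n))) s).indicator (fun _ => (1 : ℝ))
        (ω (.inl (.inr (k, 0))), ω (.inl (.inr (k, 1))), ω (.inl (.inr (k, 2))))) / n) atTop
      (𝓝 (∫ _ in ballBox (fun n => ω (.inl (.inl n))) s, (1 : ℝ) ∂ν.prod (ν.prod ν)))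
  tendsto_integral : ∀ s : Fin 3 → Finset (ℕ × ℚ), Tendsto (fun n : ℕ => (∑ k ∈ Finset.range n,
      (ballBox (fun n => ω (.inl (.inl n))) s).indicator (fun p => W p.1 p.2.1 p.2.2)
        (ω (.inl (.inr (k, 0))), ω (.inl (.inr (k, 1))), ω (.inl (.inr (k, 2))))) / n) atTop
      (𝓝 (∫ p in ballBox (fun n => ω (.inl (.inl n))) s, W p.1 p.2.1 p.2.2 ∂ν.prod (ν.prod ν)))

section Generic

variable {X : Type*} [MetricSpace X] [MeasurableSpace X] {ν : Measure X} [IsProbabilityMeasure ν]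

/-- Given the base points, the terms are i.i.d. with mean the neighborhood distance. Distinctness of
`b` and `b'` gives the pair of base points the law `ν × ν`, for which the distance formula holds
almost surely. -/
lemma IsMetricKernel.ae_tendsto_dist {W : X → X → X → ℝ} (hW : IsMetricKernel ν W)
    {b b' : BaseIndex} (hb : b ≠ b') :
    ∀ᵐ ω ∂Measure.infinitePi fun _ : SampleIndex => ν,
      Tendsto (fun n : ℕ => (∑ k ∈ Finset.range n,
        |W (ω (.inl b)) (ω (.inr (k, 0))) (ω (.inr (k, 1))) -
          W (ω (.inl b')) (ω (.inr (k, 0))) (ω (.inr (k, 1)))|) / n) atTop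
        (𝓝 (dist (ω (.inl b)) (ω (.inl b')))) := by
  obtain ⟨C, hC⟩ := hW.bounded
  have hm : ∀ c : BaseIndex, Measurable fun z : (BaseIndex → X) × (Fin 2 → X) =>
      W (z.1 c) (z.2 0) (z.2 1) := fun c =>
    hW.measurable.comp (f := fun z : (BaseIndex → X) × (Fin 2 → X) => (z.1 c, z.2 0, z.2 1))
      (by fun_prop)
  have h := ae_tendsto_block_average ν (B := BaseIndex) (κ := Fin 2)
    (F := fun x y => |W (x b) (y 0) (y 1) - W (x b') (y 0) (y 1)|)
    ((hm b).sub (hm b')).abs (C := C + C) fun x y => by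
      rw [abs_abs]
      exact (abs_sub _ _).trans (add_le_add (hC _ _ _) (hC _ _ _))
  have hd := hW.dist_eq
  rw [← Measure.infinitePi_map_eval_prod (P := fun _ : SampleIndex => ν)
    (Sum.inl_injective.ne hb)] at hd
  filter_upwards [h, ae_of_ae_map (by fun_prop) hd] with ω hω hωd
  rw [Measure.infinitePi_map_eval_prod (P := fun _ : SampleIndex => ν)
    (Sum.inl_injective.ne hb)] at hωd
  convert hω using 2
  have hsec : ∀ x : X, Measurable fun q : X × X => W x q.1 q.2 := fun x =>
    hW.measurable.comp (f := fun q : X × X => (x, q.1, q.2)) (by fun_prop)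
  have hsub : Measurable fun q : X × X => |W (ω (.inl b)) q.1 q.2 - W (ω (.inl b')) q.1 q.2| :=
    ((hsec _).sub (hsec _)).abs
  rw [hωd, ← Measure.infinitePi_map_eval_prod (P := fun _ : Fin 2 => ν) (i := 0) (j := 1)
    (by decide), integral_map (by fun_prop) hsub.aestronglyMeasurable]

variable [SecondCountableTopology X] [BorelSpace X]

lemma ae_denseRange [ν.IsOpenPosMeasure] :
    ∀ᵐ ω ∂Measure.infinitePi fun _ : ℕ => ν, DenseRange ω := by
  have hb := TopologicalSpace.isBasis_countableBasis X
  have h : ∀ᵐ ω ∂Measure.infinitePi fun _ : ℕ => ν,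
      ∀ U ∈ TopologicalSpace.countableBasis X, ∃ n, ω n ∈ U := by
    rw [ae_ball_iff (TopologicalSpace.countable_countableBasis X)]
    intro U hU
    exact ae_exists_mem_of_pos ν (hb.isOpen hU).measurableSet ((hb.isOpen hU).measure_pos ν
      (TopologicalSpace.nonempty_of_mem_countableBasis hU))
  filter_upwards [h] with ω hω
  rw [DenseRange, hb.dense_iff]
  intro U hU _
  obtain ⟨n, hn⟩ := hω U hU
  exact ⟨ω n, hn, n, rfl⟩

/-- The centers are random too, so measurability is needed jointly in the centers and the tested
triple. -/
lemma measurable_ballBox_indicator {V : X × X × X → ℝ} (hV : Measurable V)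
    (s : Fin 3 → Finset (ℕ × ℚ)) :
    Measurable fun z : (ℕ → X) × (Fin 3 → X) =>
      (ballBox z.1 s).indicator V (z.2 0, z.2 1, z.2 2) := by
  have hj : ∀ j : Fin 3, MeasurableSet
      {z : (ℕ → X) × (Fin 3 → X) | z.2 j ∈ ballInter z.1 (s j)} := by
    intro j
    have : {z : (ℕ → X) × (Fin 3 → X) | z.2 j ∈ ballInter z.1 (s j)} =
        ⋂ q ∈ s j, {z | dist (z.2 j) (z.1 q.1) < q.2} := by
      ext z
      simp [ballInter]
    rw [this]
    exact Finset.measurableSet_biInter _ fun q _ => measurableSet_lt (by fun_prop) (by fun_prop)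
  classical
  simp only [Set.indicator_apply]
  refine Measurable.ite ((hj 0).inter ((hj 1).inter (hj 2))) (hV.comp (by fun_prop))
    measurable_const

/-- The centers are independent of the triples, so conditionally on them the box is fixed and the
strong law applies. -/
lemma ae_tendsto_ballBox {V : X × X × X → ℝ} (hV : Measurable V) {C : ℝ} (hC : ∀ p, |V p| ≤ C)
    (s : Fin 3 → Finset (ℕ × ℚ)) :
    ∀ᵐ ω ∂Measure.infinitePi fun _ : SampleIndex => ν,
      Tendsto (fun n : ℕ => (∑ k ∈ Finset.range n,
        (ballBox (fun n => ω (.inl (.inl n))) s).indicator V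
          (ω (.inl (.inr (k, 0))), ω (.inl (.inr (k, 1))), ω (.inl (.inr (k, 2))))) / n) atTop
      (𝓝 (∫ p in ballBox (fun n => ω (.inl (.inl n))) s, V p ∂ν.prod (ν.prod ν))) := by
  have hm := measurable_ballBox_indicator hV s
  have h := ae_tendsto_block_average ν (B := ℕ) (κ := Fin 3)
    (F := fun x y => (ballBox x s).indicator V (y 0, y 1, y 2)) hm (C := C) fun x y => by
      have h0 : 0 ≤ C := (abs_nonneg _).trans (hC (y 0, y 1, y 2))
      by_cases h : (y 0, y 1, y 2) ∈ ballBox x s <;> simp [h, hC, h0]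
  rw [← Measure.map_infinitePi_infinitePi_of_inj (P := fun _ : SampleIndex => ν)
    (f := Sum.inl) Sum.inl_injective] at h
  filter_upwards [ae_of_ae_map
    (measurable_pi_iff.2 fun i => measurable_pi_apply (Sum.inl i)).aemeasurable h] with ω hω
  convert hω using 2
  have hbox : MeasurableSet (ballBox (fun n => ω (.inl (.inl n))) s) :=
    (isOpen_ballInter _ _).measurableSet.prod
      ((isOpen_ballInter _ _).measurableSet.prod (isOpen_ballInter _ _).measurableSet)
  rw [← integral_indicator hbox, ← infinitePi_map_eval_triple ν (ι := Fin 3) (i := 0) (j := 1)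
    (k := 2) (by decide) (by decide) (by decide),
    integral_map (by fun_prop) (hV.indicator hbox).aestronglyMeasurable]

lemma IsMetricKernel.ae_isGenericSample [ν.IsOpenPosMeasure] {W : X → X → X → ℝ}
    (hW : IsMetricKernel ν W) :
    ∀ᵐ ω ∂Measure.infinitePi fun _ : SampleIndex => ν, IsGenericSample ν W ω := by
  have h1 : ∀ᵐ ω ∂Measure.infinitePi fun _ : SampleIndex => ν,
      DenseRange fun n => ω (.inl (.inl n)) := by
    have h := ae_denseRange (ν := ν)
    rw [← Measure.map_infinitePi_infinitePi_of_inj (P := fun _ : SampleIndex => ν)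
      (f := fun n : ℕ => Sum.inl (Sum.inl n)) (Sum.inl_injective.comp Sum.inl_injective)] at h
    exact ae_of_ae_map
      (measurable_pi_iff.2 fun n => measurable_pi_apply (Sum.inl (Sum.inl n))).aemeasurable h
  have h2 := fun b b' : BaseIndex => fun hb : b ≠ b' => hW.ae_tendsto_dist hb
  simp only [← ae_all_iff] at h2
  obtain ⟨C, hC⟩ := hW.bounded
  have h3 := ae_all_iff.2 fun s => ae_tendsto_ballBox (ν := ν) (V := fun _ => 1) measurable_const
    (C := 1) (by simp) s
  have h4 := ae_all_iff.2 fun s => ae_tendsto_ballBox (ν := ν)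
    (V := fun p => W p.1 p.2.1 p.2.2) hW.measurable (C := C) (fun p => hC _ _ _) s
  filter_upwards [h1, h2, h3, h4] with ω g1 g2 g3 g4
  exact ⟨g1, g2, g3, g4⟩

end Generic

/-! ### Reconstruction of the kernel from a generic array -/

section Reconstruction

lemma IsMetricKernel.integrable {X : Type*} [MetricSpace X] [MeasurableSpace X] {ν : Measure X}
    [IsProbabilityMeasure ν] {W : X → X → X → ℝ} (hW : IsMetricKernel ν W) :
    Integrable (fun p : X × X × X => W p.1 p.2.1 p.2.2) (ν.prod (ν.prod ν)) := by
  obtain ⟨C, hC⟩ := hW.bounded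
  exact Integrable.of_bound hW.measurable.aestronglyMeasurable C
    (Eventually.of_forall fun p => hC _ _ _)

variable {X₁ X₂ : Type*} [MetricSpace X₁] [MeasurableSpace X₁] [MetricSpace X₂]
  [MeasurableSpace X₂] {ν₁ : Measure X₁} {ν₂ : Measure X₂}
  {W₁ : X₁ → X₁ → X₁ → ℝ} {W₂ : X₂ → X₂ → X₂ → ℝ}

/-- Both distances are limits of the same averages, whose terms only involve triples of distinct
indices. -/
lemma IsGenericSample.dist_eq {ω₁ : SampleIndex → X₁} {ω₂ : SampleIndex → X₂}
    (h₁ : IsGenericSample ν₁ W₁ ω₁) (h₂ : IsGenericSample ν₂ W₂ ω₂)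
    (h : offDiagArray W₁ ω₁ = offDiagArray W₂ ω₂) (b b' : BaseIndex) :
    dist (ω₁ (.inl b)) (ω₁ (.inl b')) = dist (ω₂ (.inl b)) (ω₂ (.inl b')) := by
  by_cases hb : b = b'
  · simp [hb]
  have hval : ∀ (c : BaseIndex) (k : ℕ),
      W₁ (ω₁ (.inl c)) (ω₁ (.inr (k, 0))) (ω₁ (.inr (k, 1))) =
        W₂ (ω₂ (.inl c)) (ω₂ (.inr (k, 0))) (ω₂ (.inr (k, 1))) := fun c k =>
    congrFun h ⟨(.inl c, .inr (k, 0), .inr (k, 1)), by simp⟩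
  have t := h₁.tendsto_dist b b' hb
  simp only [hval] at t
  exact tendsto_nhds_unique t (h₂.tendsto_dist b b' hb)

lemma IsGenericSample.mem_ballBox_iff {ω₁ : SampleIndex → X₁} {ω₂ : SampleIndex → X₂}
    (h₁ : IsGenericSample ν₁ W₁ ω₁) (h₂ : IsGenericSample ν₂ W₂ ω₂)
    (h : offDiagArray W₁ ω₁ = offDiagArray W₂ ω₂) (s : Fin 3 → Finset (ℕ × ℚ))
    (b c d : BaseIndex) :
    (ω₁ (.inl b), ω₁ (.inl c), ω₁ (.inl d)) ∈ ballBox (fun n => ω₁ (.inl (.inl n))) s ↔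
      (ω₂ (.inl b), ω₂ (.inl c), ω₂ (.inl d)) ∈ ballBox (fun n => ω₂ (.inl (.inl n))) s := by
  simp only [ballBox, ballInter, Set.mem_prod, Set.mem_ofPred_eq, h₁.dist_eq h₂ h]

lemma IsGenericSample.measure_ballBox_eq {ω₁ : SampleIndex → X₁} {ω₂ : SampleIndex → X₂}
    (h₁ : IsGenericSample ν₁ W₁ ω₁) (h₂ : IsGenericSample ν₂ W₂ ω₂)
    (h : offDiagArray W₁ ω₁ = offDiagArray W₂ ω₂) (s : Fin 3 → Finset (ℕ × ℚ)) :
    (ν₁.prod (ν₁.prod ν₁)).real (ballBox (fun n => ω₁ (.inl (.inl n))) s) =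
      (ν₂.prod (ν₂.prod ν₂)).real (ballBox (fun n => ω₂ (.inl (.inl n))) s) := by
  classical
  have t₁ := h₁.tendsto_measure s
  have t₂ := h₂.tendsto_measure s
  simp only [Set.indicator_apply, h₁.mem_ballBox_iff h₂ h] at t₁
  simp only [Set.indicator_apply] at t₂
  simpa using tendsto_nhds_unique t₁ t₂

lemma IsGenericSample.setIntegral_ballBox_eq {ω₁ : SampleIndex → X₁} {ω₂ : SampleIndex → X₂}
    (h₁ : IsGenericSample ν₁ W₁ ω₁) (h₂ : IsGenericSample ν₂ W₂ ω₂)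
    (h : offDiagArray W₁ ω₁ = offDiagArray W₂ ω₂) (s : Fin 3 → Finset (ℕ × ℚ)) :
    ∫ p in ballBox (fun n => ω₁ (.inl (.inl n))) s, W₁ p.1 p.2.1 p.2.2 ∂ν₁.prod (ν₁.prod ν₁) =
      ∫ p in ballBox (fun n => ω₂ (.inl (.inl n))) s,
        W₂ p.1 p.2.1 p.2.2 ∂ν₂.prod (ν₂.prod ν₂) := by
  classical
  have hval : ∀ k : ℕ,
      W₁ (ω₁ (.inl (.inr (k, 0)))) (ω₁ (.inl (.inr (k, 1)))) (ω₁ (.inl (.inr (k, 2)))) =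
        W₂ (ω₂ (.inl (.inr (k, 0)))) (ω₂ (.inl (.inr (k, 1)))) (ω₂ (.inl (.inr (k, 2)))) :=
    fun k => congrFun h ⟨(.inl (.inr (k, 0)), .inl (.inr (k, 1)), .inl (.inr (k, 2))), by simp⟩
  have t₁ := h₁.tendsto_integral s
  have t₂ := h₂.tendsto_integral s
  simp only [Set.indicator_apply, h₁.mem_ballBox_iff h₂ h, hval] at t₁
  simp only [Set.indicator_apply] at t₂
  exact tendsto_nhds_unique t₁ t₂

variable [CompleteSpace X₁] [SecondCountableTopology X₁] [BorelSpace X₁] [CompleteSpace X₂]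
  [SecondCountableTopology X₂] [BorelSpace X₂] [IsProbabilityMeasure ν₁] [IsProbabilityMeasure ν₂]

/-- Two generic samples with the same observed values come from isomorphic kernels. -/
lemma IsGenericSample.exists_isometryEquiv {ω₁ : SampleIndex → X₁} {ω₂ : SampleIndex → X₂}
    (hW₁ : IsMetricKernel ν₁ W₁) (hW₂ : IsMetricKernel ν₂ W₂)
    (h₁ : IsGenericSample ν₁ W₁ ω₁) (h₂ : IsGenericSample ν₂ W₂ ω₂)
    (h : offDiagArray W₁ ω₁ = offDiagArray W₂ ω₂) :
    ∃ ρ : X₁ ≃ᵢ X₂, MeasurePreserving ρ ν₁ ν₂ ∧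
      ∀ᵐ p ∂ν₁.prod (ν₁.prod ν₁), W₁ p.1 p.2.1 p.2.2 = W₂ (ρ p.1) (ρ p.2.1) (ρ p.2.2) := by
  obtain ⟨ρ, hρ⟩ := exists_isometryEquiv_of_dist_eq h₁.dense h₂.dense
    fun i j => h₁.dist_eq h₂ h (.inl i) (.inl j)
  set x₁ := fun n => ω₁ (.inl (.inl n)) with hx₁
  set x₂ := fun n => ω₂ (.inl (.inl n)) with hx₂
  have hpre : ∀ s, ρ ⁻¹' ballInter x₂ s = ballInter x₁ s := by
    intro s
    ext a
    have : ∀ n, dist (ρ a) (x₂ n) = dist a (x₁ n) := fun n => by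
      rw [show x₂ n = ρ (x₁ n) from (hρ n).symm, ρ.dist_eq]
    simp [ballInter, this]
  have hmeas : Measurable ρ := ρ.continuous.measurable
  have hmp : MeasurePreserving ρ ν₁ ν₂ := by
    refine ⟨hmeas, ?_⟩
    have : IsProbabilityMeasure (ν₁.map ρ) := Measure.isProbabilityMeasure_map hmeas.aemeasurable
    refine ext_of_generate_finite _ (generateFrom_range_ballInter h₂.dense).symm
      (isPiSystem_range_ballInter _) ?_ (by simp)
    rintro _ ⟨s, rfl⟩
    -- Empty constraints on the last two factors leave them equal to the whole space, so the box has
    -- the measure of its first factor.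
    have hs := h₁.measure_ballBox_eq h₂ h ![s, ∅, ∅]
    simp only [ballBox, Matrix.cons_val, ballInter_empty, Set.univ_prod_univ, measureReal_prod_prod,
      probReal_univ, mul_one] at hs
    rw [Measure.map_apply hmeas (isOpen_ballInter _ _).measurableSet, hpre]
    exact (measureReal_eq_measureReal_iff).1 hs
  refine ⟨ρ, hmp, ?_⟩
  have hmp3 : MeasurePreserving (Prod.map ρ (Prod.map ρ ρ)) (ν₁.prod (ν₁.prod ν₁))
      (ν₂.prod (ν₂.prod ν₂)) := hmp.prod (hmp.prod hmp)
  have hemb : MeasurableEmbedding (Prod.map ρ (Prod.map ρ ρ)) := by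
    have := ρ.toHomeomorph.measurableEmbedding
    exact this.prodMap (this.prodMap this)
  have hint : Integrable (fun p : X₁ × X₁ × X₁ => W₂ (ρ p.1) (ρ p.2.1) (ρ p.2.2))
      (ν₁.prod (ν₁.prod ν₁)) := hmp3.integrable_comp_of_integrable hW₂.integrable
  have hbox : ∀ s, ∫ p in ballBox x₁ s, W₁ p.1 p.2.1 p.2.2 ∂ν₁.prod (ν₁.prod ν₁) =
      ∫ p in ballBox x₁ s, W₂ (ρ p.1) (ρ p.2.1) (ρ p.2.2) ∂ν₁.prod (ν₁.prod ν₁) := by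
    intro s
    rw [h₁.setIntegral_ballBox_eq h₂ h, ← hmp3.setIntegral_preimage_emb hemb]
    simp only [ballBox, Set.preimage_prod_map_prod, ← hx₂, hpre, Prod.map]
  have hgen := generateFrom_range_ballInter h₁.dense
  have hspan := isCountablySpanning_range_ballInter x₁
  have hpi := isPiSystem_range_ballInter x₁
  refine ae_eq_of_setIntegral_eq_of_isPiSystem hW₁.integrable hint
    (generateFrom_eq_prod hgen (generateFrom_eq_prod hgen hgen hspan hspan) hspan
      (hspan.prod hspan)).symm (hpi.prod (hpi.prod hpi)) ?_ ?_
  · simpa [ballBox] using hbox fun _ => ∅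
  · rintro _ ⟨_, ⟨s, rfl⟩, _, ⟨_, ⟨t, rfl⟩, _, ⟨u, rfl⟩, rfl⟩, rfl⟩
    exact hbox ![s, t, u]

/-- Metric kernels with the same distribution of off-diagonal samples are isomorphic. -/
theorem exists_isometryEquiv_of_map_offDiagArray_eq [ν₁.IsOpenPosMeasure] [ν₂.IsOpenPosMeasure]
    (hW₁ : IsMetricKernel ν₁ W₁) (hW₂ : IsMetricKernel ν₂ W₂)
    (h : (Measure.infinitePi fun _ : SampleIndex => ν₁).map (offDiagArray W₁) =
      (Measure.infinitePi fun _ : SampleIndex => ν₂).map (offDiagArray W₂)) :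
    ∃ ρ : X₁ ≃ᵢ X₂, MeasurePreserving ρ ν₁ ν₂ ∧
      ∀ᵐ p ∂ν₁.prod (ν₁.prod ν₁), W₁ p.1 p.2.1 p.2.2 = W₂ (ρ p.1) (ρ p.2.1) (ρ p.2.2) := by
  have m₁ := measurable_offDiagArray (I := SampleIndex) hW₁.measurable
  have m₂ := measurable_offDiagArray (I := SampleIndex) hW₂.measurable
  have e₁ := ae_map_exists_eq m₁ hW₁.ae_isGenericSample
  have e₂ := ae_map_exists_eq m₂ hW₂.ae_isGenericSample
  rw [← h] at e₂
  have := Measure.isProbabilityMeasure_map (μ := Measure.infinitePi fun _ : SampleIndex => ν₁)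
    m₁.aemeasurable
  -- Two almost sure properties of the common law hold together at some array, which has a generic
  -- preimage on each side.
  obtain ⟨a, ⟨ω₁, g₁, rfl⟩, ω₂, g₂, h₂⟩ := (e₁.and e₂).exists
  exact g₁.exists_isometryEquiv hW₁ hW₂ g₂ h₂.symm

end Reconstruction

/-! ### From pure kernels to Borel kernels on the neighborhood space -/

namespace TripleKernel

section NbhdSpace

variable {J : Type*} [MeasurableSpace J] (K : TripleKernel J)

/-- The space `J` of a pure kernel, endowed with the neighborhood distance and its Borel
σ-algebra. -/
def NbhdSpace (_ : K.IsPure) : Type _ := J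

variable (hK : K.IsPure)

/-- The identity map from `J` to `NbhdSpace`. -/
def toNbhd : J ≃ K.NbhdSpace hK := Equiv.refl J

noncomputable instance : MetricSpace (K.NbhdSpace hK) where
  toPseudoMetricSpace := K.nbhdPseudoMetric
  eq_of_dist_eq_zero {x y} h := hK.eq_of_nbhdDist_eq_zero x y h

instance : CompleteSpace (K.NbhdSpace hK) := hK.complete

instance : SecondCountableTopology (K.NbhdSpace hK) :=
  have : TopologicalSpace.SeparableSpace (K.NbhdSpace hK) := hK.separable
  UniformSpace.secondCountable_of_separable _

noncomputable instance : MeasurableSpace (K.NbhdSpace hK) := borel _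

instance : BorelSpace (K.NbhdSpace hK) := ⟨rfl⟩

lemma measurable_nbhdDist (x : J) : Measurable (K.nbhdDist x) := by
  have h1 : Measurable fun q : J × J × J => K.W x q.2.1 q.2.2 :=
    K.measurable_W.comp (f := fun q : J × J × J => (x, q.2)) (by fun_prop)
  have h2 : Measurable fun q : J × J × J => |K.W x q.2.1 q.2.2 - K.W q.1 q.2.1 q.2.2| :=
    (h1.sub K.measurable_W).abs
  exact (h2.stronglyMeasurable.integral_prod_right
    (f := fun (x' : J) (p : J × J) => |K.W x p.1 p.2 - K.W x' p.1 p.2|)).measurable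

/-- Balls are measurable because the distance to a fixed point is, by Fubini; by separability every
open set is a countable union of balls. -/
lemma measurable_toNbhd : Measurable (K.toNbhd hK) := by
  refine measurable_of_isOpen fun U hU => ?_
  choose! r hr hrU using Metric.isOpen_iff.1 hU
  obtain ⟨T, hT, hTU⟩ := TopologicalSpace.isOpen_iUnion_countable
    (fun x : U => Metric.ball (x : K.NbhdSpace hK) (r x)) fun _ => Metric.isOpen_ball
  have hU' : U = ⋃ x ∈ T, Metric.ball (x : K.NbhdSpace hK) (r x) := by
    rw [hTU]
    refine Set.Subset.antisymm (fun x hx => Set.mem_iUnion.2 ⟨⟨x, hx⟩, ?_⟩)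
      (Set.iUnion_subset fun x => hrU x x.2)
    exact Metric.mem_ball_self (hr x hx)
  rw [hU', Set.preimage_iUnion₂]
  refine MeasurableSet.biUnion hT fun x _ => ?_
  have : K.toNbhd hK ⁻¹' Metric.ball (x : K.NbhdSpace hK) (r x) =
      {y | K.nbhdDist ((K.toNbhd hK).symm x) y < r x} := by
    ext y
    rw [Set.mem_preimage, Metric.mem_ball, dist_comm]
    rfl
  rw [this]
  exact measurableSet_lt (K.measurable_nbhdDist _) measurable_const

/-- The measure of a pure kernel, as a Borel measure for the neighborhood distance. -/
noncomputable def nbhdMeasure : Measure (K.NbhdSpace hK) := K.μ.map (K.toNbhd hK)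

lemma measurePreserving_toNbhd : MeasurePreserving (K.toNbhd hK) K.μ (K.nbhdMeasure hK) :=
  ⟨K.measurable_toNbhd hK, rfl⟩

instance : IsProbabilityMeasure (K.nbhdMeasure hK) :=
  Measure.isProbabilityMeasure_map (K.measurable_toNbhd hK).aemeasurable

instance : (K.nbhdMeasure hK).IsOpenPosMeasure where
  open_pos U hU hne := by
    rw [nbhdMeasure, Measure.map_apply (K.measurable_toNbhd hK) hU.measurableSet]
    exact (hK.fullSupport U hU hne).ne'

variable {K hK}

lemma nullMeasurableSet_nbhd_of_measurableSet (hB : K.IsBorelUpToCompletion)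
    {A : Set (K.NbhdSpace hK)} (hA : MeasurableSet (K.toNbhd hK ⁻¹' A)) :
    NullMeasurableSet A (K.nbhdMeasure hK) := by
  obtain ⟨B, C, hBm, hCm, hBA, hAC, h0⟩ : ∃ B C : Set (K.NbhdSpace hK), MeasurableSet B ∧
      MeasurableSet C ∧ B ⊆ A ∧ A ⊆ C ∧ K.μ (K.toNbhd hK ⁻¹' (C \ B)) = 0 := hB _ hA
  rw [← Measure.map_apply (K.measurable_toNbhd hK) (hCm.diff hBm)] at h0
  refine hBm.nullMeasurableSet.congr (Filter.EventuallyLE.antisymm ?_ ?_)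
  · exact LE.le.eventuallyLE hBA
  · rw [ae_le_set]
    exact measure_mono_null (Set.sdiff_subset_sdiff_left hAC) h0

/-- For the converse direction, a set measurable for the completion is a measurable set together
with part of a measurable null set, and `hB` applies to both. -/
lemma nullMeasurableSet_nbhd_iff (hB : K.IsBorelUpToCompletion) {A : Set (K.NbhdSpace hK)} :
    NullMeasurableSet A (K.nbhdMeasure hK) ↔ NullMeasurableSet (K.toNbhd hK ⁻¹' A) K.μ := by
  refine ⟨fun h => h.preimage (K.measurePreserving_toNbhd hK).quasiMeasurePreserving,
    fun h => ?_⟩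
  obtain ⟨t, htA, ht, htae⟩ := h.exists_measurable_subset_ae_eq
  obtain ⟨N, hN, hNm, hN0⟩ := exists_measurable_superset_of_null (ae_le_set.1 htae.symm.le)
  have hN' : NullMeasurableSet ((K.toNbhd hK).symm ⁻¹' N) (K.nbhdMeasure hK) :=
    nullMeasurableSet_nbhd_of_measurableSet hB hNm
  have hN0' : K.nbhdMeasure hK ((K.toNbhd hK).symm ⁻¹' N) = 0 := by
    rw [← (K.measurePreserving_toNbhd hK).measure_preimage hN']
    exact hN0
  have ht' : NullMeasurableSet ((K.toNbhd hK).symm ⁻¹' t) (K.nbhdMeasure hK) :=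
    nullMeasurableSet_nbhd_of_measurableSet hB ht
  have hd : NullMeasurableSet (A \ ((K.toNbhd hK).symm ⁻¹' t)) (K.nbhdMeasure hK) :=
    NullMeasurableSet.of_null (measure_mono_null hN hN0')
  have hA : A = ((K.toNbhd hK).symm ⁻¹' t) ∪ (A \ ((K.toNbhd hK).symm ⁻¹' t)) :=
    (Set.union_sdiff_cancel htA).symm
  rw [hA]
  exact ht'.union hd

lemma nbhdMeasure_apply (hB : K.IsBorelUpToCompletion) {A : Set (K.NbhdSpace hK)}
    (hA : NullMeasurableSet (K.toNbhd hK ⁻¹' A) K.μ) :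
    K.nbhdMeasure hK A = K.μ (K.toNbhd hK ⁻¹' A) :=
  ((K.measurePreserving_toNbhd hK).measure_preimage
    ((nullMeasurableSet_nbhd_iff hB).2 hA)).symm

/-- Measurable sets of `J` are Borel up to null sets, and this passes to the cube because pulling
back along each projection preserves null sets. -/
lemma nullMeasurable_nbhd (hB : K.IsBorelUpToCompletion) :
    NullMeasurable (fun p : K.NbhdSpace hK × K.NbhdSpace hK × K.NbhdSpace hK =>
      K.W ((K.toNbhd hK).symm p.1) ((K.toNbhd hK).symm p.2.1) ((K.toNbhd hK).symm p.2.2))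
      ((K.nbhdMeasure hK).prod ((K.nbhdMeasure hK).prod (K.nbhdMeasure hK))) := by
  let X := K.NbhdSpace hK
  let ν := K.nbhdMeasure hK
  have key : ∀ f : X × X × X → X, Measure.QuasiMeasurePreserving f (ν.prod (ν.prod ν)) ν →
      @Measurable (NullMeasurableSpace (X × X × X) (ν.prod (ν.prod ν))) J _ _
        (fun p => (K.toNbhd hK).symm (f p)) := by
    intro f hf A hA
    have : NullMeasurableSet ((K.toNbhd hK).symm ⁻¹' A) ν :=
      nullMeasurableSet_nbhd_of_measurableSet hB hA
    exact this.preimage hf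
  have h1 := key Prod.fst Measure.quasiMeasurePreserving_fst
  have h2 := key (fun p => p.2.1)
    (Measure.quasiMeasurePreserving_fst.comp Measure.quasiMeasurePreserving_snd)
  have h3 := key (fun p => p.2.2)
    (Measure.quasiMeasurePreserving_snd.comp Measure.quasiMeasurePreserving_snd)
  exact fun s hs => (K.measurable_W.comp (h1.prodMk (h2.prodMk h3))) hs

lemma exists_isMetricKernel (hB : K.IsBorelUpToCompletion) :
    ∃ W' : K.NbhdSpace hK → K.NbhdSpace hK → K.NbhdSpace hK → ℝ,
      IsMetricKernel (K.nbhdMeasure hK) W' ∧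
      ∀ᵐ p ∂(K.nbhdMeasure hK).prod ((K.nbhdMeasure hK).prod (K.nbhdMeasure hK)),
        K.W ((K.toNbhd hK).symm p.1) ((K.toNbhd hK).symm p.2.1) ((K.toNbhd hK).symm p.2.2) =
          W' p.1 p.2.1 p.2.2 := by
  obtain ⟨C, hC⟩ := K.bounded_W
  have hae := (nullMeasurable_nbhd (hK := hK) hB).aemeasurable
  let W' : K.NbhdSpace hK → K.NbhdSpace hK → K.NbhdSpace hK → ℝ :=
    -- Truncation makes the Borel version bounded everywhere and changes nothing where it equals
    -- `K.W`.
    fun x y z => max (-C) (min C (hae.mk _ (x, y, z)))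
  have heq : ∀ᵐ p ∂(K.nbhdMeasure hK).prod ((K.nbhdMeasure hK).prod (K.nbhdMeasure hK)),
      K.W ((K.toNbhd hK).symm p.1) ((K.toNbhd hK).symm p.2.1) ((K.toNbhd hK).symm p.2.2) =
        W' p.1 p.2.1 p.2.2 := by
    filter_upwards [hae.ae_eq_mk] with p hp
    have := abs_le.1 (hC ((K.toNbhd hK).symm p.1) ((K.toNbhd hK).symm p.2.1)
      ((K.toNbhd hK).symm p.2.2))
    simp only [W']
    rw [← hp, min_eq_right this.2, max_eq_right this.1]
  have hm : Measurable fun p : K.NbhdSpace hK × K.NbhdSpace hK × K.NbhdSpace hK =>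
      W' p.1 p.2.1 p.2.2 := measurable_const.max (measurable_const.min hae.measurable_mk)
  refine ⟨W', ⟨hm, ⟨|C|, fun x y z => ?_⟩, ?_⟩, heq⟩
  · rw [abs_le]
    exact ⟨(neg_le_neg (le_abs_self C)).trans (le_max_left _ _),
      max_le (neg_le_abs C) ((min_le_left _ _).trans (le_abs_self C))⟩
  · have hsec : ∀ x, Measurable fun q : K.NbhdSpace hK × K.NbhdSpace hK => W' x q.1 q.2 :=
      fun x => hm.comp (f := fun q : K.NbhdSpace hK × K.NbhdSpace hK => (x, q.1, q.2))
        (by fun_prop)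
    have hmp := (K.measurePreserving_toNbhd hK).prod (K.measurePreserving_toNbhd hK)
    -- Only almost every section of `W'` agrees almost everywhere with that of `K.W`, so the
    -- distance formula holds for almost every pair.
    have hae' := Measure.ae_ae_of_ae_prod heq
    filter_upwards [Measure.quasiMeasurePreserving_fst.ae hae',
      Measure.quasiMeasurePreserving_snd.ae hae'] with p h1 h2
    have hsub : Measurable fun q : K.NbhdSpace hK × K.NbhdSpace hK =>
        |W' p.1 q.1 q.2 - W' p.2 q.1 q.2| := ((hsec _).sub (hsec _)).abs
    rw [← hmp.map_eq, integral_map hmp.measurable.aemeasurable hsub.aestronglyMeasurable]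
    refine integral_congr_ae ?_
    filter_upwards [hmp.quasiMeasurePreserving.ae h1, hmp.quasiMeasurePreserving.ae h2]
      with q e1 e2
    exact congrArg abs (congrArg₂ (· - ·) e1 e2)

/-- Points with three distinct indices have joint law `μ³`, so a `μ³`-null modification of the
kernel is almost surely invisible in the countable off-diagonal array. -/
lemma map_offDiagArray_nbhd {W' : K.NbhdSpace hK → K.NbhdSpace hK → K.NbhdSpace hK → ℝ}
    (hm : Measurable fun p : K.NbhdSpace hK × K.NbhdSpace hK × K.NbhdSpace hK =>
      W' p.1 p.2.1 p.2.2)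
    (h : ∀ᵐ p ∂(K.nbhdMeasure hK).prod ((K.nbhdMeasure hK).prod (K.nbhdMeasure hK)),
        K.W ((K.toNbhd hK).symm p.1) ((K.toNbhd hK).symm p.2.1) ((K.toNbhd hK).symm p.2.2) =
          W' p.1 p.2.1 p.2.2)
    (I : Type*) [Countable I] :
    (Measure.infinitePi fun _ : I => K.nbhdMeasure hK).map (offDiagArray W') =
      (Measure.infinitePi fun _ : I => K.μ).map (offDiagArray K.W) := by
  have e : (Measure.infinitePi fun _ : I => K.nbhdMeasure hK) =
      (Measure.infinitePi fun _ : I => K.μ).map (fun ω i => K.toNbhd hK (ω i)) :=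
    (Measure.infinitePi_map_pi (fun _ : I => K.μ) fun _ => K.measurable_toNbhd hK).symm
  have hto : Measurable fun (ω : I → J) i => K.toNbhd hK (ω i) :=
    measurable_pi_iff.2 fun i => (K.measurable_toNbhd hK).comp (measurable_pi_apply i)
  rw [e, Measure.map_map (measurable_offDiagArray hm) hto]
  refine Measure.map_congr ?_
  have : ∀ᵐ ω ∂Measure.infinitePi fun _ : I => K.μ, ∀ t : OffDiag I,
      K.W (ω t.1.1) (ω t.1.2.1) (ω t.1.2.2) = W' (K.toNbhd hK (ω t.1.1))
        (K.toNbhd hK (ω t.1.2.1)) (K.toNbhd hK (ω t.1.2.2)) := by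
    rw [ae_all_iff]
    rintro ⟨⟨i, j, k⟩, hij, hik, hjk⟩
    have hmp := K.measurePreserving_toNbhd hK
    have h' := (hmp.prod (hmp.prod hmp)).quasiMeasurePreserving.ae h
    rw [← infinitePi_map_eval_triple K.μ hij hik hjk] at h'
    exact ae_of_ae_map (by fun_prop) h'
  filter_upwards [this] with ω hω
  funext t
  exact (hω t).symm

end NbhdSpace

/-! ### From finite sampling laws to infinite arrays -/

section SampleLaw

variable {J₁ J₂ : Type*} [MeasurableSpace J₁] [MeasurableSpace J₂]
  {K₁ : TripleKernel J₁} {K₂ : TripleKernel J₂}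

lemma measurable_sample {J : Type*} [MeasurableSpace J] (K : TripleKernel J) (n : ℕ) :
    Measurable (K.sample n) :=
  measurable_pi_iff.2 fun i => measurable_pi_iff.2 fun j => measurable_pi_iff.2 fun k =>
    K.measurable_W.comp (f := fun x : Fin n → J => (x i, x j, x k)) (by fun_prop)

instance {J : Type*} [MeasurableSpace J] (K : TripleKernel J) (n : ℕ) :
    IsProbabilityMeasure (K.sampleLaw n) :=
  Measure.isProbabilityMeasure_map (K.measurable_sample n).aemeasurable

lemma sampleLaw_singleton {J : Type*} [MeasurableSpace J] (K : TripleKernel J) {n : ℕ}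
    (H : Fin n → Fin n → Fin n → ℝ) : K.sampleLaw n {H} = K.density H :=
  Measure.map_apply (K.measurable_sample n) (measurableSet_singleton H)

/-- A probability measure carried by a countable set is determined by its atoms. -/
lemma eq_of_measure_singleton_eq {S : Type*} [MeasurableSpace S] [MeasurableSingletonClass S]
    {P Q : Measure S} [IsProbabilityMeasure P] [IsProbabilityMeasure Q] {T : Set S}
    (hT : T.Countable) (hPT : P Tᶜ = 0) (h : ∀ a ∈ T, P {a} = Q {a}) : P = Q := by
  have hsub : ∀ U ⊆ T, P U = Q U := by
    intro U hU
    have hc := hT.mono hU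
    rw [← Set.biUnion_of_singleton U,
      measure_biUnion hc (fun a _ b _ hab => by simpa using hab)
        fun a _ => measurableSet_singleton a,
      measure_biUnion hc (fun a _ b _ hab => by simpa using hab)
        fun a _ => measurableSet_singleton a]
    exact tsum_congr fun a => h a (hU a.2)
  -- The atoms in `T` already exhaust the total mass of `P`, hence also that of `Q`.
  have hQT : Q Tᶜ = 0 := by
    rw [prob_compl_eq_zero_iff hT.measurableSet] at hPT ⊢
    rw [← hsub T subset_rfl, hPT]
  ext E _
  rw [← measure_inter_conull hPT, ← measure_inter_conull hQT]
  exact hsub _ Set.inter_subset_right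

/-- Samples of `K₁` take values in a countable set, as finite arrays with entries in a countable
set. Nothing is required of the values of `K₂`, since equal densities force its sample law onto the
same set. -/
lemma sampleLaw_eq_of_density_eq
    (hc : (Set.range fun p : J₁ × J₁ × J₁ => K₁.W p.1 p.2.1 p.2.2).Countable) {n : ℕ}
    (h : ∀ H : Fin n → Fin n → Fin n → ℝ, K₁.density H = K₂.density H) :
    K₁.sampleLaw n = K₂.sampleLaw n := by
  set R := Set.range fun p : J₁ × J₁ × J₁ => K₁.W p.1 p.2.1 p.2.2 with hR
  have hT : {H : Fin n → Fin n → Fin n → ℝ | ∀ i, H i ∈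
      {G : Fin n → Fin n → ℝ | ∀ j, G j ∈ {F : Fin n → ℝ | ∀ k, F k ∈ R}}}.Countable :=
    Set.countable_pi fun _ => Set.countable_pi fun _ => Set.countable_pi fun _ => hc
  refine eq_of_measure_singleton_eq hT ?_ fun H _ => by
    rw [sampleLaw_singleton, sampleLaw_singleton, h]
  rw [prob_compl_eq_zero_iff hT.measurableSet, sampleLaw,
    Measure.map_apply (K₁.measurable_sample n) hT.measurableSet]
  convert measure_univ (μ := Measure.pi fun _ : Fin n => K₁.μ)
  exact Set.eq_univ_of_forall fun x i j k => ⟨(x i, x j, x k), rfl⟩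

lemma measurable_array {J : Type*} [MeasurableSpace J] (K : TripleKernel J) :
    Measurable fun (ω : ℕ → J) (t : ℕ × ℕ × ℕ) => K.W (ω t.1) (ω t.2.1) (ω t.2.2) :=
  measurable_pi_iff.2 fun t =>
    K.measurable_W.comp (f := fun ω : ℕ → J => (ω t.1, ω t.2.1, ω t.2.2)) (by fun_prop)

lemma map_restrict_array {J : Type*} [MeasurableSpace J] (K : TripleKernel J)
    {S : Finset (ℕ × ℕ × ℕ)} {n : ℕ} (hS : ∀ t ∈ S, t.1 < n ∧ t.2.1 < n ∧ t.2.2 < n) :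
    ((Measure.infinitePi fun _ : ℕ => K.μ).map
        (fun ω (t : ℕ × ℕ × ℕ) => K.W (ω t.1) (ω t.2.1) (ω t.2.2))).map S.restrict =
      (K.sampleLaw n).map (fun H (t : S) => H ⟨t.1.1, (hS t.1 t.2).1⟩ ⟨t.1.2.1, (hS t.1 t.2).2.1⟩
        ⟨t.1.2.2, (hS t.1 t.2).2.2⟩) := by
  rw [sampleLaw, ← Measure.infinitePi_eq_pi, ← Measure.map_infinitePi_infinitePi_of_inj
    (P := fun _ : ℕ => K.μ) (f := (Fin.val : Fin n → ℕ)) Fin.val_injective,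
    Measure.map_map (K.measurable_sample n) (by fun_prop),
    Measure.map_map (by fun_prop) ((K.measurable_sample n).comp (by fun_prop)),
    Measure.map_map (by fun_prop) K.measurable_array]
  rfl

/-- Finitely many entries of the array are read off from a sample of some finite size, and
finite-dimensional marginals determine the law. -/
lemma map_array_eq (h : ∀ n, 0 < n → K₁.sampleLaw n = K₂.sampleLaw n) :
    (Measure.infinitePi fun _ : ℕ => K₁.μ).map
        (fun ω (t : ℕ × ℕ × ℕ) => K₁.W (ω t.1) (ω t.2.1) (ω t.2.2)) =
      (Measure.infinitePi fun _ : ℕ => K₂.μ).map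
        (fun ω (t : ℕ × ℕ × ℕ) => K₂.W (ω t.1) (ω t.2.1) (ω t.2.2)) := by
  refine IsProjectiveLimit.unique (P := fun S : Finset (ℕ × ℕ × ℕ) =>
    ((Measure.infinitePi fun _ : ℕ => K₁.μ).map
      (fun ω (t : ℕ × ℕ × ℕ) => K₁.W (ω t.1) (ω t.2.1) (ω t.2.2))).map S.restrict)
    (fun S => rfl) fun S => ?_
  let n := S.sup (fun t => t.1 + t.2.1 + t.2.2) + 1
  have hS : ∀ t ∈ S, t.1 < n ∧ t.2.1 < n ∧ t.2.2 < n := fun t ht => by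
    have : t.1 + t.2.1 + t.2.2 ≤ S.sup (fun t => t.1 + t.2.1 + t.2.2) :=
      Finset.le_sup (f := fun t : ℕ × ℕ × ℕ => t.1 + t.2.1 + t.2.2) ht
    omega
  beta_reduce
  rw [map_restrict_array K₁ hS, map_restrict_array K₂ hS, h n (Nat.succ_pos _)]

lemma map_offDiagArray_eq_map_array {J : Type*} [MeasurableSpace J] (K : TripleKernel J)
    {I : Type*} {e : I → ℕ} (he : Function.Injective e) :
    (Measure.infinitePi fun _ : I => K.μ).map (offDiagArray K.W) =
      ((Measure.infinitePi fun _ : ℕ => K.μ).map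
        (fun ω (t : ℕ × ℕ × ℕ) => K.W (ω t.1) (ω t.2.1) (ω t.2.2))).map
        (fun a (t : OffDiag I) => a (e t.1.1, e t.1.2.1, e t.1.2.2)) := by
  rw [← Measure.map_infinitePi_infinitePi_of_inj (P := fun _ : ℕ => K.μ) he,
    Measure.map_map (measurable_offDiagArray K.measurable_W) (by fun_prop),
    Measure.map_map (by fun_prop) K.measurable_array]
  rfl

lemma map_offDiagArray_eq (h : ∀ n, 0 < n → K₁.sampleLaw n = K₂.sampleLaw n)
    (I : Type*) [Countable I] :
    (Measure.infinitePi fun _ : I => K₁.μ).map (offDiagArray K₁.W) =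
      (Measure.infinitePi fun _ : I => K₂.μ).map (offDiagArray K₂.W) := by
  obtain ⟨e, he⟩ := Countable.exists_injective_nat I
  rw [map_offDiagArray_eq_map_array K₁ he, map_offDiagArray_eq_map_array K₂ he, map_array_eq h]

end SampleLaw

end TripleKernel

/-! ### Return to the original spaces and conclusion -/

lemma MeasureTheory.MeasurePreserving.preservesMeasure_nbhd {J₁ J₂ : Type*} [MeasurableSpace J₁]
    [MeasurableSpace J₂] {K₁ : TripleKernel J₁} {K₂ : TripleKernel J₂} {hK₁ : K₁.IsPure}
    {hK₂ : K₂.IsPure} (hB₁ : K₁.IsBorelUpToCompletion) (hB₂ : K₂.IsBorelUpToCompletion)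
    {ρ : K₁.NbhdSpace hK₁ → K₂.NbhdSpace hK₂}
    (hρ : MeasurePreserving ρ (K₁.nbhdMeasure hK₁) (K₂.nbhdMeasure hK₂)) :
    PreservesMeasure K₁.μ K₂.μ fun x => (K₂.toNbhd hK₂).symm (ρ (K₁.toNbhd hK₁ x)) := by
  intro A hA
  have hA' : NullMeasurableSet ((K₂.toNbhd hK₂).symm ⁻¹' A) (K₂.nbhdMeasure hK₂) :=
    (TripleKernel.nullMeasurableSet_nbhd_iff hB₂).2 hA
  have hA₁ := (TripleKernel.nullMeasurableSet_nbhd_iff hB₁).1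
    (hA'.preimage hρ.quasiMeasurePreserving)
  refine ⟨hA₁, (TripleKernel.nbhdMeasure_apply hB₁ hA₁).symm.trans ?_⟩
  rw [hρ.measure_preimage hA']
  exact TripleKernel.nbhdMeasure_apply hB₂ hA

theorem mainTheorem7 {J₁ J₂ : Type*} [MeasurableSpace J₁] [MeasurableSpace J₂]
    (K₁ : TripleKernel J₁) (K₂ : TripleKernel J₂)
    (hpure₁ : K₁.IsPure) (hpure₂ : K₂.IsPure)
    (hborel₁ : K₁.IsBorelUpToCompletion) (hborel₂ : K₂.IsBorelUpToCompletion)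
    (h : (∀ n : ℕ, 0 < n → K₁.sampleLaw n = K₂.sampleLaw n) ∨
      ((Set.range fun p : J₁ × J₁ × J₁ => K₁.W p.1 p.2.1 p.2.2).Countable ∧
        ∀ n : ℕ, 0 < n → ∀ H : Fin n → Fin n → Fin n → ℝ, K₁.density H = K₂.density H)) :
    ∃ ρ : J₁ ≃ J₂,
      (∀ x x' : J₁, K₂.nbhdDist (ρ x) (ρ x') = K₁.nbhdDist x x') ∧
      PreservesMeasure K₁.μ K₂.μ ρ ∧ PreservesMeasure K₂.μ K₁.μ ρ.symm ∧
      ∀ᵐ p ∂(K₁.μ.prod (K₁.μ.prod K₁.μ)),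
        K₁.W p.1 p.2.1 p.2.2 = K₂.W (ρ p.1) (ρ p.2.1) (ρ p.2.2) := by
  have hlaw : ∀ n : ℕ, 0 < n → K₁.sampleLaw n = K₂.sampleLaw n := by
    rcases h with h | ⟨hc, h⟩
    · exact h
    · exact fun n hn => TripleKernel.sampleLaw_eq_of_density_eq hc (h n hn)
  obtain ⟨W₁, hW₁, he₁⟩ := TripleKernel.exists_isMetricKernel (hK := hpure₁) hborel₁
  obtain ⟨W₂, hW₂, he₂⟩ := TripleKernel.exists_isMetricKernel (hK := hpure₂) hborel₂
  obtain ⟨ρ, hρ, hρW⟩ := exists_isometryEquiv_of_map_offDiagArray_eq hW₁ hW₂ (by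
    rw [TripleKernel.map_offDiagArray_nbhd hW₁.measurable he₁,
      TripleKernel.map_offDiagArray_nbhd hW₂.measurable he₂,
      TripleKernel.map_offDiagArray_eq hlaw])
  have hsymm : MeasurePreserving ρ.symm (K₂.nbhdMeasure hpure₂) (K₁.nbhdMeasure hpure₁) :=
    hρ.symm ρ.toHomeomorph.toMeasurableEquiv
  refine ⟨(K₁.toNbhd hpure₁).trans (ρ.toEquiv.trans (K₂.toNbhd hpure₂).symm),
    fun x x' => ρ.dist_eq _ _, hρ.preservesMeasure_nbhd hborel₁ hborel₂,
    hsymm.preservesMeasure_nbhd hborel₂ hborel₁, ?_⟩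
  have hmp := K₁.measurePreserving_toNbhd hpure₁
  have he₂' := (hρ.prod (hρ.prod hρ)).quasiMeasurePreserving.ae he₂
  filter_upwards [(hmp.prod (hmp.prod hmp)).quasiMeasurePreserving.ae
    (he₁.and (hρW.and he₂'))] with p hp
  exact hp.1.trans (hp.2.1.trans hp.2.2.symm)
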